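/- Let $\mathbb D=\{z\in\mathbb C:|z|<1\}$ and, for a non-empty open set $U\subseteq\mathbb C$, let $A^2(U)$ be the Bergman space of $U$, i.e. the Hilbert space of holomorphic functions on $U$ that are square integrable with respect to Lebesgue measure. For a non-empty open set $U\subset\mathbb D$ let $R_U:A^2(\mathbb D)\to A^2(U)$, $R_Uf=f|_U$, be the restriction operator and let $T_U=R_U^*R_U:A^2(\mathbb D)\to A^2(\mathbb D)$ (equivalently, $T_U$ is the Toeplitz operator on $A^2(\mathbb D)$ whose symbol is the characteristic function of $U$). (1) If $U$ is a horodisc, i.e. $U=\{z:|z-(1-\rho)\zeta|<\rho\}$ for some $|\zeta|=1$ and $0<\rho<1$ (an open Euclidean disc in $\mathbb D$, different from $\mathbb D$, whose boundary circle is internally tangent to the unit circle), then the spectrum of $T_U$ is the interval $[0,1]$. (2) Let $0<\rho_1<\rho_2<1$ and let $U$ be the horocyclic strip between two horocycles of Euclidean radii $\rho_1$ and $\rho_2$ tangent to the unit circle at the same point, i.e. $U=\{z:|z-(1-\rho_2)\zeta|<\rho_2,\ |z-(1-\rho_1)\zeta|>\rho_1\}$ for some $|\zeta|=1$. Then the spectrum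 of $T_U$ is the interval $$\left[0,\ \alpha^{-\frac1{\alpha-1}}-\alpha^{-\frac{\alpha}{\alpha-1}}\right],\qquad \alpha=\frac{\frac1{\rho_1}-1}{\frac1{\rho_2}-1}.$$ -/

import Mathlib

open MeasureTheory Set Metric Filter Topology
open scoped ENNReal

namespace BergmanRestriction

/-! ### Bergman spaces -/

/-- Sub-mean-value inequality for the square of the modulus of a holomorphic function. -/
theorem area_mul_sq_le {g : ℂ → ℂ} {c : ℂ} {r : ℝ}
    (hg : DifferentiableOn ℂ g (ball c r)) :
    (∫⁻ s in Ioo (0 : ℝ) r, ENNReal.ofReal s) * (ENNReal.ofReal (2 * Real.pi) * ‖g c‖ₑ ^ 2)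
      ≤ ∫⁻ z in ball c r, ‖g z‖ₑ ^ 2 := by
  have step1 : ∀ s ∈ Ioo (0 : ℝ) r, ENNReal.ofReal (2 * Real.pi) * ‖g c‖ₑ ^ 2 ≤
      ∫⁻ θ in Ioo (-Real.pi) Real.pi, ‖g (circleMap c s θ)‖ₑ ^ 2 := by
    intro s hs
    have hsub : closedBall c |s| ⊆ ball c r := by
      rw [abs_of_pos hs.1]; exact closedBall_subset_ball hs.2
    have hd : DiffContOnCl ℂ (fun z => g z ^ 2) (ball c |s|) :=
      ((hg.pow 2).mono hsub).diffContOnCl_ball le_rfl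
    have h1 := hd.circleAverage
    have hper : Function.Periodic (fun θ => g (circleMap c s θ) ^ 2) (2 * Real.pi) := fun θ => by
      simp only [periodic_circleMap c s θ]
    have h2 := hper.intervalIntegral_add_eq 0 (-Real.pi)
    have e : -Real.pi + 2 * Real.pi = Real.pi := by ring
    rw [zero_add, e] at h2
    rw [Real.circleAverage_def, h2] at h1
    have h3 : (∫ θ in (-Real.pi)..Real.pi, g (circleMap c s θ) ^ 2)
        = ((2 * Real.pi : ℝ)) • g c ^ 2 := by
      rw [← h1, smul_smul, mul_inv_cancel₀ (by positivity), one_smul]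
    have h4 : ENNReal.ofReal (2 * Real.pi) * ‖g c‖ₑ ^ 2
        = ‖∫ θ in (-Real.pi)..Real.pi, g (circleMap c s θ) ^ 2‖ₑ := by
      rw [h3, enorm_smul, enorm_pow, Real.enorm_eq_ofReal (by positivity)]
    rw [h4, intervalIntegral.integral_of_le (by linarith [Real.pi_pos]),
      ← restrict_Ioo_eq_restrict_Ioc]
    refine (enorm_integral_le_lintegral_enorm _).trans (le_of_eq ?_)
    simp only [enorm_pow]
  set F : ℂ → ℝ≥0∞ := (ball c r).indicator (fun z => ‖g z‖ₑ ^ 2) with hF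
  have hFm : Measurable F := by
    have : ContinuousOn (fun z => ‖g z‖ₑ ^ 2) (ball c r) :=
      (ENNReal.continuous_pow 2).comp_continuousOn hg.continuousOn.enorm
    classical
    have h := this.measurable_piecewise (g := fun _ => (0 : ℝ≥0∞)) continuousOn_const
      measurableSet_ball
    rw [hF, ← Set.piecewise_eq_indicator]
    exact h
  have e1 : ∫⁻ z in ball c r, ‖g z‖ₑ ^ 2 = ∫⁻ z, F (c + z) := by
    rw [lintegral_add_left_eq_self (fun z => F z) c, hF, lintegral_indicator measurableSet_ball]
  rw [e1, ← Complex.lintegral_comp_polarCoord_symm, polarCoord_target,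
    Measure.volume_eq_prod, ← Measure.prod_restrict]
  have hcm : ∀ p : ℝ × ℝ, c + Complex.polarCoord.symm p = circleMap c p.1 p.2 := fun p => by
    rw [Complex.polarCoord_symm_apply, circleMap, Complex.exp_mul_I,
      Complex.ofReal_cos, Complex.ofReal_sin]
  simp only [hcm, smul_eq_mul]
  have hcont : Continuous fun p : ℝ × ℝ => circleMap c p.1 p.2 := by
    unfold circleMap; fun_prop
  have hm : Measurable fun p : ℝ × ℝ => ENNReal.ofReal p.1 * F (circleMap c p.1 p.2) :=
    (by fun_prop : Measurable fun p : ℝ × ℝ => ENNReal.ofReal p.1).mul (hFm.comp hcont.measurable)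
  rw [lintegral_prod _ hm.aemeasurable,
    ← lintegral_mul_const _ (by fun_prop)]
  refine le_trans ?_ (lintegral_mono_set (Ioo_subset_Ioi_self : Ioo 0 r ⊆ Ioi 0))
  refine setLIntegral_mono' measurableSet_Ioo fun s hs => ?_
  have hms : Measurable fun θ : ℝ => F (circleMap c s θ) :=
    hFm.comp (continuous_circleMap c s).measurable
  change _ ≤ ∫⁻ θ in Ioo (-Real.pi) Real.pi, ENNReal.ofReal s * F (circleMap c s θ)
  rw [lintegral_const_mul _ hms]
  gcongr
  refine (step1 s hs).trans (le_of_eq (lintegral_congr fun θ => ?_))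
  have : circleMap c s θ ∈ ball c r := by
    simpa [circleMap, abs_of_pos hs.1] using hs.2
  rw [hF, indicator_of_mem this]

/-- Point evaluations are bounded for the `L²` norm. -/
theorem exists_norm_le {r : ℝ} (hr : 0 < r) : ∃ C : ℝ, 0 ≤ C ∧
    ∀ (Ω : Set ℂ) (f : Lp ℂ 2 (volume.restrict Ω)) (g : ℂ → ℂ) (c : ℂ),
      DifferentiableOn ℂ g Ω → f =ᵐ[volume.restrict Ω] g → ball c r ⊆ Ω → ‖g c‖ ≤ C * ‖f‖ := by
  set K : ℝ≥0∞ := (∫⁻ s in Ioo (0 : ℝ) r, ENNReal.ofReal s) * ENNReal.ofReal (2 * Real.pi) with hK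
  have hK0 : K ≠ 0 := by
    refine mul_ne_zero ?_ (by simp [Real.pi_pos])
    rw [← pos_iff_ne_zero, setLIntegral_pos_iff (by fun_prop)]
    have : Function.support (fun s : ℝ => ENNReal.ofReal s) ∩ Ioo 0 r = Ioo 0 r := by
      refine inter_eq_right.2 fun s hs => ?_
      simpa [Function.mem_support] using hs.1
    rw [this]; simpa using hr
  have hKt : K ≠ ∞ := by
    refine ENNReal.mul_ne_top (ne_of_lt ?_) ENNReal.ofReal_ne_top
    calc ∫⁻ s in Ioo (0 : ℝ) r, ENNReal.ofReal s ≤ ∫⁻ _ in Ioo (0 : ℝ) r, ENNReal.ofReal r :=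
          setLIntegral_mono' measurableSet_Ioo fun s hs => ENNReal.ofReal_le_ofReal hs.2.le
      _ < ∞ := by
          rw [setLIntegral_const]; exact ENNReal.mul_lt_top (by simp) (by simp)
  refine ⟨√(K.toReal⁻¹), Real.sqrt_nonneg _, fun Ω f g c hg hfg hc => ?_⟩
  have h1 : K * ‖g c‖ₑ ^ 2 ≤ ‖f‖ₑ ^ 2 := by
    rw [hK, mul_assoc]
    refine (area_mul_sq_le (hg.mono hc)).trans ?_
    have h2 : ‖f‖ₑ ^ 2 = ∫⁻ z in Ω, ‖g z‖ₑ ^ 2 := by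
      rw [Lp.enorm_def, eLpNorm_congr_ae hfg,
        eLpNorm_eq_lintegral_rpow_enorm_toReal (by norm_num) (by norm_num),
        ← ENNReal.rpow_natCast, ← ENNReal.rpow_mul]
      norm_num
    rw [h2]
    exact lintegral_mono_set hc
  have h3 : K.toReal * ‖g c‖ ^ 2 ≤ ‖f‖ ^ 2 := by
    have := ENNReal.toReal_mono (by simp) h1
    simpa [ENNReal.toReal_mul, ENNReal.toReal_pow] using this
  have hKp : 0 < K.toReal := ENNReal.toReal_pos hK0 hKt
  refine le_of_sq_le_sq ?_ (by positivity)
  rw [mul_pow, Real.sq_sqrt (by positivity), inv_mul_eq_div, le_div_iff₀ hKp, mul_comm]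
  exact h3

/-- The Bergman space `A²(Ω)`, as the subspace of `L²(Ω)` of (classes of) functions that are
holomorphic on `Ω`. -/
noncomputable def bergmanSpace (Ω : TopologicalSpace.Opens ℂ) :
    Submodule ℂ (Lp ℂ 2 (volume.restrict (Ω : Set ℂ))) where
  carrier := {f | ∃ g : ℂ → ℂ, DifferentiableOn ℂ g Ω ∧ f =ᵐ[volume.restrict (Ω : Set ℂ)] g}
  zero_mem' := ⟨0, differentiableOn_const 0, Lp.coeFn_zero _ _ _⟩
  add_mem' := by
    rintro f₁ f₂ ⟨g₁, hg₁, h₁⟩ ⟨g₂, hg₂, h₂⟩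
    exact ⟨g₁ + g₂, hg₁.add hg₂, (Lp.coeFn_add f₁ f₂).trans (h₁.add h₂)⟩
  smul_mem' := by
    rintro a f ⟨g, hg, h⟩
    exact ⟨a • g, hg.const_smul a, (Lp.coeFn_smul a f).trans (h.const_smul a)⟩

theorem isClosed_bergmanSpace (Ω : TopologicalSpace.Opens ℂ) :
    IsClosed (bergmanSpace Ω : Set (Lp ℂ 2 (volume.restrict (Ω : Set ℂ)))) := by
  refine isClosed_of_closure_subset fun f hf => ?_
  obtain ⟨u, hu, hlim⟩ := mem_closure_iff_seq_limit.1 hf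
  choose G hG hGu using hu
  have hcauchy := hlim.cauchySeq
  have hdiff : ∀ n m, ((u n - u m : Lp ℂ 2 (volume.restrict (Ω : Set ℂ))) : ℂ → ℂ)
      =ᵐ[volume.restrict (Ω : Set ℂ)] G n - G m := fun n m =>
    (Lp.coeFn_sub _ _).trans ((hGu n).sub (hGu m))
  have hloc : ∀ z ∈ Ω, ∃ r > 0, ball z r ⊆ Ω ∧ UniformCauchySeqOn G atTop (ball z r) := by
    intro z hz
    obtain ⟨ε, hε, hb⟩ := Metric.isOpen_iff.1 Ω.isOpen z hz
    refine ⟨ε / 2, by positivity, (ball_subset_ball (by linarith)).trans hb, ?_⟩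
    obtain ⟨C, hC0, hC⟩ := exists_norm_le (r := ε / 2) (by positivity)
    rw [Metric.uniformCauchySeqOn_iff]
    intro δ hδ
    obtain ⟨N, hN⟩ := Metric.cauchySeq_iff.1 hcauchy (δ / (C + 1)) (by positivity)
    refine ⟨N, fun m hm n hn x hx => ?_⟩
    have hsub : ball x (ε / 2) ⊆ Ω := by
      refine (ball_subset_ball' ?_).trans hb
      have := mem_ball.1 hx
      linarith
    have h1 := hC Ω (u m - u n) (G m - G n) x ((hG m).sub (hG n)) (hdiff m n) hsub
    have h2 := hN m hm n hn
    rw [dist_eq_norm] at h2 ⊢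
    rw [lt_div_iff₀ (by positivity)] at h2
    simp only [Pi.sub_apply] at h1
    nlinarith [norm_nonneg (u m - u n)]
  have hpt : ∀ z : ℂ, ∃ l, z ∈ Ω → Tendsto (fun n => G n z) atTop (𝓝 l) := by
    intro z
    by_cases hz : z ∈ Ω
    · obtain ⟨r, hr, -, h⟩ := hloc z hz
      obtain ⟨l, hl⟩ := cauchySeq_tendsto_of_complete (h.cauchySeq (mem_ball_self hr))
      exact ⟨l, fun _ => hl⟩
    · exact ⟨0, fun h => absurd h hz⟩
  choose g hg using hpt
  have hunif : TendstoLocallyUniformlyOn G g atTop Ω := by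
    intro v hv z hz
    obtain ⟨r, hr, hsub, h⟩ := hloc z hz
    have := h.tendstoUniformlyOn_of_tendsto (fun x hx => hg x (hsub hx))
    exact ⟨ball z r, mem_nhdsWithin_of_mem_nhds (ball_mem_nhds z hr), this v hv⟩
  refine ⟨g, hunif.differentiableOn (Eventually.of_forall hG) Ω.isOpen, ?_⟩
  obtain ⟨ns, hns, hae⟩ := (tendstoInMeasure_of_tendsto_Lp hlim).exists_seq_tendsto_ae
  have hall : ∀ᵐ x ∂(volume.restrict (Ω : Set ℂ)), ∀ n, u n x = G n x := ae_all_iff.2 hGu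
  filter_upwards [hae, hall, ae_restrict_mem Ω.isOpen.measurableSet] with x hx hx' hxΩ
  refine tendsto_nhds_unique hx ?_
  simp only [hx']
  exact (hg x hxΩ).comp hns.tendsto_atTop

noncomputable instance (Ω : TopologicalSpace.Opens ℂ) : CompleteSpace (bergmanSpace Ω) :=
  (isClosed_bergmanSpace Ω).completeSpace_coe

/-! ### The restriction operator and its Toeplitz operator -/

/-- Restriction of `L²` functions to a smaller set. -/
noncomputable def restrictL2 {s t : Set ℂ} (h : s ⊆ t) :
    Lp ℂ 2 (volume.restrict t) →L[ℂ] Lp ℂ 2 (volume.restrict s) :=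
  LinearMap.mkContinuous
    { toFun := fun f =>
        ((Lp.memLp f).mono_measure (Measure.restrict_mono_set volume h)).toLp f
      map_add' := fun f₁ f₂ => by
        refine Lp.ext ?_
        filter_upwards [Lp.coeFn_add
            (((Lp.memLp f₁).mono_measure (Measure.restrict_mono_set volume h)).toLp f₁)
            (((Lp.memLp f₂).mono_measure (Measure.restrict_mono_set volume h)).toLp f₂),
          ((Lp.memLp f₁).mono_measure (Measure.restrict_mono_set volume h)).coeFn_toLp,
          ((Lp.memLp f₂).mono_measure (Measure.restrict_mono_set volume h)).coeFn_toLp,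
          ((Lp.memLp (f₁ + f₂)).mono_measure (Measure.restrict_mono_set volume h)).coeFn_toLp,
          ae_restrict_of_ae_restrict_of_subset h (Lp.coeFn_add f₁ f₂)] with x h1 h2 h3 h4 h5
        rw [h1, h4, h5, Pi.add_apply, Pi.add_apply, h2, h3]
      map_smul' := fun a f => by
        refine Lp.ext ?_
        filter_upwards [Lp.coeFn_smul a
            (((Lp.memLp f).mono_measure (Measure.restrict_mono_set volume h)).toLp f),
          ((Lp.memLp f).mono_measure (Measure.restrict_mono_set volume h)).coeFn_toLp,
          ((Lp.memLp (a • f)).mono_measure (Measure.restrict_mono_set volume h)).coeFn_toLp,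
          ae_restrict_of_ae_restrict_of_subset h (Lp.coeFn_smul a f)] with x h1 h2 h4 h5
        rw [RingHom.id_apply, h1, h4, h5, Pi.smul_apply, Pi.smul_apply, h2] }
    1 (fun f => by
      rw [one_mul]
      change ‖((Lp.memLp f).mono_measure (Measure.restrict_mono_set volume h)).toLp f‖ ≤ ‖f‖
      rw [Lp.norm_toLp, Lp.norm_def]
      exact ENNReal.toReal_mono (Lp.eLpNorm_ne_top _)
        (eLpNorm_mono_measure _ (Measure.restrict_mono_set volume h)))

theorem restrictL2_ae {s t : Set ℂ} (h : s ⊆ t) (f : Lp ℂ 2 (volume.restrict t)) :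
    restrictL2 h f =ᵐ[volume.restrict s] f :=
  MemLp.coeFn_toLp ((Lp.memLp f).mono_measure (Measure.restrict_mono_set volume h))

/-- The restriction operator `R_U : A²(Ω) → A²(U)`, `f ↦ f|_U`. -/
noncomputable def restrictionOp {U Ω : TopologicalSpace.Opens ℂ} (h : U ≤ Ω) :
    bergmanSpace Ω →L[ℂ] bergmanSpace U :=
  ((restrictL2 (s := (U : Set ℂ)) (t := (Ω : Set ℂ)) h).comp (bergmanSpace Ω).subtypeL).codRestrict
    (bergmanSpace U) (fun f => by
      obtain ⟨g, hg, hfg⟩ := f.2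
      exact ⟨g, hg.mono h,
        (restrictL2_ae (s := (U : Set ℂ)) (t := (Ω : Set ℂ)) h f.1).trans
          (ae_restrict_of_ae_restrict_of_subset h hfg)⟩)

/-- The operator `T_U = R_U^* R_U` on `A²(Ω)`. -/
noncomputable def toeplitzOp {U Ω : TopologicalSpace.Opens ℂ} (h : U ≤ Ω) :
    bergmanSpace Ω →L[ℂ] bergmanSpace Ω :=
  (restrictionOp h).adjoint ∘L restrictionOp h

/-! ### Horodiscs and horocyclic strips in the unit disc -/

/-- The open unit disc `𝔻`. -/
def unitDisc : TopologicalSpace.Opens ℂ := ⟨ball 0 1, isOpen_ball⟩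

/-- `U` is a horodisc of the unit disc: an open Euclidean disc, of some radius `0 < ρ < 1`, that is
internally tangent to the unit circle at some point `ζ`. -/
def IsHorodisc (U : TopologicalSpace.Opens ℂ) : Prop :=
  ∃ (ζ : ℂ) (ρ : ℝ), ‖ζ‖ = 1 ∧ 0 < ρ ∧ ρ < 1 ∧ (U : Set ℂ) = ball ((1 - ρ : ℝ) * ζ) ρ

/-- `U` is the horocyclic strip between the two horocycles of Euclidean radii `ρ₁` (the inner one)
and `ρ₂` (the outer one) that are tangent to the unit circle at the same point `ζ`. -/
def IsHorocyclicStrip (U : TopologicalSpace.Opens ℂ) (ρ₁ ρ₂ : ℝ) : Prop :=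
  ∃ ζ : ℂ, ‖ζ‖ = 1 ∧
    (U : Set ℂ) = {z : ℂ | ‖z - (1 - ρ₂ : ℝ) * ζ‖ < ρ₂ ∧ ρ₁ < ‖z - (1 - ρ₁ : ℝ) * ζ‖}

end BergmanRestriction

/-!
The Cayley transform that sends the point of tangency to `∞` maps the unit disc to the right
half-plane and a horodisc of radius `1 / (1 + s)` to the half-plane `re w > s`. The Bergman kernel
of a half-plane depends on `w + conj z` only, so on the smaller half-plane the kernel of the large
one with pole `z` is the kernel of the small one with pole `z + 2 * s`. Hence the Toeplitz operator
`T s` of the horodisc is the translation `f ↦ f (· + 2 * s)`, and `T (s + t) = T s * T t`. All of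
this is carried out in the disc, where the two kernels are Bergman kernels of Euclidean discs and
the translation is a parabolic Möbius transformation with the factor of its derivative; see
`integral_mul_discKernel`, `discKernel_horodisc`, `toeplitzOp_horodisc_apply` and
`toeplitzOp_horodisc_add`.

So `T` is a decreasing semigroup of positive contractions. For the constant function `1`,
`⟨1, T s ^ n 1⟩ = ⟨1, T (n * s) 1⟩` is the area `π / (1 + n * s) ^ 2` of a horodisc. These are the
moments of the image of `π * t * exp (-t) dt` on `(0, ∞)` under `t ↦ exp (-(s * t))`, a measure with
support `[0, 1]`; therefore the spectrum of `T s` is `[0, 1]` (`spectrum_eq_Icc_of_moments`).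

The Toeplitz operator of a horocyclic strip is `T s - T t` with `t / s = α`. Uniqueness of positive
roots and monotonicity give `T t = T s ^ α` (`semigroup_mul_eq_rpow`), so by the spectral mapping
theorem the spectrum is the range of `x - x ^ α` on `[0, 1]` (`image_sub_rpow_Icc`).
-/

namespace BergmanRestriction

open scoped ComplexConjugate
open TopologicalSpace (Opens)

/-! ### The reproducing property of the Bergman kernel of a disc -/

/-- The Bergman kernel of the disc `ball c R`, holomorphic in `z` and antiholomorphic in `w`. -/
noncomputable def discKernel (c : ℂ) (R : ℝ) (z w : ℂ) : ℂ :=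
  (R : ℂ) ^ 2 / (Real.pi * ((R : ℂ) ^ 2 - (z - c) * conj (w - c)) ^ 2)

theorem sq_sub_mul_conj_ne_zero {R : ℝ} {z w : ℂ} (hz : ‖z‖ < R) (hw : ‖w‖ ≤ R) :
    (R : ℂ) ^ 2 - z * conj w ≠ 0 := by
  intro h
  have h1 : ‖(R : ℂ) ^ 2‖ = ‖z‖ * ‖w‖ := by
    rw [sub_eq_zero.1 h, norm_mul, RCLike.norm_conj]
  have hR : 0 < R := (norm_nonneg z).trans_lt hz
  rw [norm_pow, Complex.norm_real, Real.norm_of_nonneg hR.le] at h1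
  nlinarith [norm_nonneg z, norm_nonneg w]

/-- The angular integral in the reproducing formula, by Cauchy's formula for the derivative: on
the circle `‖w‖ = r` one has `conj w = r² / w`. -/
theorem integral_circleMap_mul_discKernel {R r : ℝ} {g : ℂ → ℂ} {z : ℂ} (hr : 0 < r) (hrR : r < R)
    (hg : DifferentiableOn ℂ g (ball 0 R)) (hz : ‖z‖ < R) :
    ∫ θ in (-Real.pi)..Real.pi, g (circleMap 0 r θ) * discKernel 0 R z (circleMap 0 r θ) =
      2 / (R : ℂ) ^ 2 * deriv (fun w => w * g w) (z * r ^ 2 / R ^ 2) := by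
  have hR : 0 < R := hr.trans hrR
  have hRc : (R : ℂ) ≠ 0 := by exact_mod_cast hR.ne'
  set v : ℂ := z * r ^ 2 / R ^ 2 with hv
  have hvr : v ∈ ball (0 : ℂ) r := by
    rw [mem_ball_zero_iff, hv, norm_div, norm_mul, norm_pow, norm_pow, Complex.norm_real,
      Complex.norm_real, Real.norm_of_nonneg hR.le, Real.norm_of_nonneg hr.le,
      div_lt_iff₀ (by positivity)]
    have h1 : ‖z‖ * r < R * R := by nlinarith [norm_nonneg z]
    nlinarith
  have hper : Function.Periodic
      (fun θ => g (circleMap 0 r θ) * discKernel 0 R z (circleMap 0 r θ)) (2 * Real.pi) :=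
    fun θ => by simp only [periodic_circleMap 0 r θ]
  have h2 := hper.intervalIntegral_add_eq 0 (-Real.pi)
  have e : -Real.pi + 2 * Real.pi = Real.pi := by ring
  rw [zero_add, e] at h2
  have hc := Complex.two_pi_I_inv_smul_circleIntegral_sub_sq_inv_smul_of_differentiable
    (isOpen_ball (x := (0 : ℂ)) (ε := R)) (closedBall_subset_ball hrR)
    (differentiableOn_id.mul hg) hvr
  have hc' : deriv (fun w => w * g w) v = deriv (id * g) v := rfl
  rw [← h2, hc', ← hc, circleIntegral, smul_eq_mul, ← intervalIntegral.integral_const_mul,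
    ← intervalIntegral.integral_const_mul]
  refine intervalIntegral.integral_congr fun θ _ => ?_
  set w := circleMap 0 r θ with hw
  have hwn : ‖w‖ = r := by simp [hw, abs_of_pos hr]
  have hw0 : w ≠ 0 := by rw [← norm_pos_iff, hwn]; exact hr
  have hwc : conj w = (r : ℂ) ^ 2 / w := by
    rw [eq_div_iff hw0, mul_comm, Complex.mul_conj, Complex.normSq_eq_norm_sq, hwn]
    push_cast; ring
  have hwv : w - v ≠ 0 := by
    intro h
    rw [sub_eq_zero] at h
    rw [← h, mem_ball_zero_iff, hwn] at hvr
    exact lt_irrefl _ hvr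
  have hk : (R : ℂ) ^ 2 - z * conj w = R ^ 2 * (w - v) / w := by
    rw [hwc, hv]; field_simp
  have hpi : (Real.pi : ℂ) ≠ 0 := by exact_mod_cast Real.pi_ne_zero
  simp only [discKernel, sub_zero, hk, deriv_circleMap, ← hw, smul_eq_mul, Pi.mul_apply, id]
  field_simp [Complex.I_ne_zero]

/-- The radial integral in the reproducing formula. -/
theorem integral_radial {R : ℝ} {g : ℂ → ℂ} {z : ℂ} (hR : 0 < R)
    (hg : DifferentiableOn ℂ g (ball 0 R)) (hz : ‖z‖ < R) :
    ∫ r in (0 : ℝ)..R, (r : ℂ) * (2 / (R : ℂ) ^ 2 *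
      deriv (fun w => w * g w) (z * r ^ 2 / R ^ 2)) = g z := by
  have hRc : (R : ℂ) ≠ 0 := by exact_mod_cast hR.ne'
  have hmem : ∀ r ∈ uIcc 0 R, z * (r : ℂ) ^ 2 / R ^ 2 ∈ ball (0 : ℂ) R := by
    intro r hr
    rw [uIcc_of_le hR.le] at hr
    rw [mem_ball_zero_iff, norm_div, norm_mul, norm_pow, norm_pow, Complex.norm_real,
      Complex.norm_real, Real.norm_of_nonneg hR.le, Real.norm_of_nonneg hr.1,
      div_lt_iff₀ (by positivity)]
    have : r ^ 2 ≤ R ^ 2 := pow_le_pow_left₀ hr.1 hr.2 2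
    nlinarith [norm_nonneg z, sq_pos_of_pos hR]
  have hG : DifferentiableOn ℂ (fun w => w * g w) (ball 0 R) := differentiableOn_id.mul hg
  have hd : ∀ r ∈ uIcc 0 R, HasDerivAt
      (fun r : ℝ => (r : ℂ) ^ 2 / R ^ 2 * g (z * (r : ℂ) ^ 2 / R ^ 2))
      ((r : ℂ) * (2 / (R : ℂ) ^ 2 * deriv (fun w => w * g w) (z * r ^ 2 / R ^ 2))) r := by
    intro r hr
    have hgd : HasDerivAt g (deriv g (z * r ^ 2 / R ^ 2)) (z * r ^ 2 / R ^ 2) :=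
      (hg.differentiableAt (isOpen_ball.mem_nhds (hmem r hr))).hasDerivAt
    have h1 : HasDerivAt (fun r : ℂ => r ^ 2 / (R : ℂ) ^ 2) (2 * r / R ^ 2) (r : ℂ) := by
      simpa using (hasDerivAt_pow 2 (r : ℂ)).div_const ((R : ℂ) ^ 2)
    have h2 : HasDerivAt (fun r : ℂ => z * r ^ 2 / (R : ℂ) ^ 2) (z * (2 * r) / R ^ 2) (r : ℂ) := by
      simpa using ((hasDerivAt_pow 2 (r : ℂ)).const_mul z).div_const ((R : ℂ) ^ 2)
    have h3 := (h1.mul (hgd.comp (r : ℂ) h2)).comp_ofReal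
    have h4 : deriv (fun w => w * g w) (z * r ^ 2 / R ^ 2) = _ :=
      ((hasDerivAt_id (z * r ^ 2 / R ^ 2 : ℂ)).mul hgd).deriv
    rw [h4]
    refine h3.congr_deriv ?_
    simp only [id, Function.comp]
    field_simp
  have hcont : ContinuousOn (fun r : ℝ => (r : ℂ) * (2 / (R : ℂ) ^ 2 *
      deriv (fun w => w * g w) (z * r ^ 2 / R ^ 2))) (uIcc 0 R) := by
    have h1 : ContinuousOn (fun r : ℝ => deriv (fun w => w * g w) (z * r ^ 2 / R ^ 2))
        (uIcc 0 R) :=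
      (hG.deriv isOpen_ball).continuousOn.comp (by fun_prop) hmem
    fun_prop
  rw [intervalIntegral.integral_eq_sub_of_hasDerivAt hd hcont.intervalIntegrable]
  have : z * (R : ℂ) ^ 2 / R ^ 2 = z := by field_simp
  rw [this]
  simp [hRc]

theorem continuousOn_discKernel {c z : ℂ} {R : ℝ} (hz : z ∈ ball c R) :
    ContinuousOn (discKernel c R z) (closedBall c R) := by
  unfold discKernel
  refine ContinuousOn.div (by fun_prop) ?_ fun w hw => ?_
  · have : Continuous fun w : ℂ => conj (w - c) := Complex.continuous_conj.comp (by fun_prop)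
    fun_prop
  · refine mul_ne_zero (by exact_mod_cast Real.pi_ne_zero) (pow_ne_zero 2 ?_)
    exact sq_sub_mul_conj_ne_zero (mem_ball_iff_norm.1 hz) (mem_closedBall_iff_norm.1 hw)

theorem integrableOn_mul_discKernel {c z : ℂ} {R : ℝ} {g : ℂ → ℂ}
    (hint : IntegrableOn g (ball c R)) (hz : z ∈ ball c R) :
    IntegrableOn (fun w => g w * discKernel c R z w) (ball c R) := by
  obtain ⟨C, hC⟩ := (isCompact_closedBall c R).exists_bound_of_continuousOn
    (continuousOn_discKernel hz)
  have hm : AEStronglyMeasurable (discKernel c R z) (volume.restrict (ball c R)) :=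
    ((continuousOn_discKernel hz).mono ball_subset_closedBall).aestronglyMeasurable
      measurableSet_ball
  refine Integrable.mul_bdd (c := C) hint hm ?_
  filter_upwards [ae_restrict_mem measurableSet_ball] with w hw
  exact hC w (ball_subset_closedBall hw)

/-- Integration in polar coordinates over a disc centred at `0`. -/
theorem setIntegral_ball_eq_polar {R : ℝ} {F : ℂ → ℂ} (hR : 0 < R)
    (hc : ContinuousOn F (ball 0 R)) (hF : IntegrableOn F (ball 0 R)) :
    ∫ w in ball 0 R, F w =
      ∫ r in (0 : ℝ)..R, (r : ℂ) * ∫ θ in (-Real.pi)..Real.pi, F (circleMap 0 r θ) := by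
  classical
  set G : ℂ → ℂ := (ball 0 R).indicator F with hG
  have hGm : Measurable G := by
    have h := hc.measurable_piecewise (g := fun _ => (0 : ℂ)) continuousOn_const measurableSet_ball
    rw [hG, ← Set.piecewise_eq_indicator]
    exact h
  have hcm : ∀ p : ℝ × ℝ, Complex.polarCoord.symm p = circleMap 0 p.1 p.2 := fun p => by
    rw [Complex.polarCoord_symm_apply, circleMap, Complex.exp_mul_I,
      Complex.ofReal_cos, Complex.ofReal_sin, zero_add]
  have hcont : Continuous fun p : ℝ × ℝ => circleMap 0 p.1 p.2 := by
    unfold circleMap; fun_prop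
  have hm : Measurable fun p : ℝ × ℝ => p.1 • G (circleMap 0 p.1 p.2) :=
    measurable_fst.smul (hGm.comp hcont.measurable)
  have hpi : polarCoord.target = Ioi (0 : ℝ) ×ˢ Ioo (-Real.pi) Real.pi := polarCoord_target
  have hint : IntegrableOn (fun p : ℝ × ℝ => p.1 • G (circleMap 0 p.1 p.2))
      (Ioi (0 : ℝ) ×ˢ Ioo (-Real.pi) Real.pi) (volume.prod volume) := by
    refine ⟨hm.aestronglyMeasurable, ?_⟩
    have h1 : ∫⁻ z, ‖G z‖ₑ < ∞ := by
      have := (hF.integrable_indicator measurableSet_ball).2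
      exact this
    rw [← Complex.lintegral_comp_polarCoord_symm, hpi] at h1
    rw [hasFiniteIntegral_iff_enorm]
    refine lt_of_le_of_lt (le_of_eq ?_) h1
    rw [← Measure.volume_eq_prod]
    refine setLIntegral_congr_fun (measurableSet_Ioi.prod measurableSet_Ioo) fun p hp => ?_
    simp only [hcm, enorm_smul, smul_eq_mul]
    rw [Real.enorm_eq_ofReal (le_of_lt hp.1)]
  rw [← integral_indicator measurableSet_ball, ← hG, ← Complex.integral_comp_polarCoord_symm, hpi,
    Measure.volume_eq_prod]
  simp only [hcm]
  rw [setIntegral_prod _ hint, intervalIntegral.integral_of_le hR.le,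
    integral_Ioc_eq_integral_Ioo]
  have hsub : Ioo 0 R ⊆ Ioi (0 : ℝ) := Ioo_subset_Ioi_self
  have hz : ∀ r ∈ Ioi (0 : ℝ) \ Ioo 0 R,
      ∫ θ in Ioo (-Real.pi) Real.pi, r • G (circleMap 0 r θ) = 0 := by
    intro r hr
    have hrR : R ≤ r := not_lt.1 fun h => hr.2 ⟨hr.1, h⟩
    have : ∀ θ, G (circleMap 0 r θ) = 0 := fun θ => by
      refine indicator_of_notMem ?_ _
      simpa [abs_of_pos (show 0 < r from hr.1)] using hrR
    simp [this]
  rw [setIntegral_eq_of_subset_of_forall_sdiff_eq_zero measurableSet_Ioi hsub hz]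
  refine setIntegral_congr_fun measurableSet_Ioo fun r hr => ?_
  have hin : ∀ θ, G (circleMap 0 r θ) = F (circleMap 0 r θ) := fun θ => by
    refine indicator_of_mem ?_ _
    simpa [abs_of_pos hr.1] using hr.2
  simp only [hin, Complex.real_smul]
  rw [integral_const_mul, intervalIntegral.integral_of_le (by linarith [Real.pi_pos]),
    integral_Ioc_eq_integral_Ioo]

/-- The reproducing property of the Bergman kernel of a disc. -/
theorem integral_mul_discKernel {c z : ℂ} {R : ℝ} {g : ℂ → ℂ}
    (hg : DifferentiableOn ℂ g (ball c R)) (hint : IntegrableOn g (ball c R))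
    (hz : z ∈ ball c R) :
    ∫ w in ball c R, g w * discKernel c R z w = g z := by
  have hR : 0 < R := dist_nonneg.trans_lt (mem_ball.1 hz)
  have hpre : (fun w : ℂ => c + w) ⁻¹' ball c R = ball 0 R := by ext w; simp
  have hmp := measurePreserving_add_left (volume : Measure ℂ) c
  have hme := (MeasurableEquiv.addLeft c).measurableEmbedding
  have hint' : IntegrableOn (fun w => g (c + w)) (ball 0 R) := by
    have := (hmp.integrableOn_comp_preimage hme (f := g) (s := ball c R)).2 hint
    rwa [hpre] at this
  have hg' : DifferentiableOn ℂ (fun w => g (c + w)) (ball 0 R) := by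
    refine hg.comp (by fun_prop) fun w hw => ?_
    rw [← hpre] at hw; exact hw
  have hz' : ‖z - c‖ < R := mem_ball_iff_norm.1 hz
  have hz0 : z - c ∈ ball (0 : ℂ) R := mem_ball_zero_iff.2 hz'
  have hk : ∀ w, discKernel c R z (c + w) = discKernel 0 R (z - c) w := fun w => by
    simp [discKernel]
  have h1 := hmp.setIntegral_preimage_emb hme (fun w => g w * discKernel c R z w) (ball c R)
  rw [hpre] at h1
  simp only [hk] at h1
  have hcont : ContinuousOn (fun w => g (c + w) * discKernel 0 R (z - c) w) (ball 0 R) :=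
    hg'.continuousOn.mul ((continuousOn_discKernel hz0).mono ball_subset_closedBall)
  rw [← h1, setIntegral_ball_eq_polar hR hcont (integrableOn_mul_discKernel hint' hz0)]
  have h2 := integral_radial hR hg' hz'
  rw [add_sub_cancel] at h2
  rw [← h2, intervalIntegral.integral_of_le hR.le, intervalIntegral.integral_of_le hR.le,
    integral_Ioc_eq_integral_Ioo, integral_Ioc_eq_integral_Ioo]
  refine setIntegral_congr_fun measurableSet_Ioo fun r hr => ?_
  rw [← integral_circleMap_mul_discKernel hr.1 hr.2 hg' hz']

/-! ### Toeplitz operators as quadratic forms -/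

theorem inner_bergmanSpace_eq {Ω : Opens ℂ} {f₁ f₂ : bergmanSpace Ω} {g₁ g₂ : ℂ → ℂ}
    (h₁ : (f₁ : Lp ℂ 2 (volume.restrict (Ω : Set ℂ))) =ᵐ[volume.restrict (Ω : Set ℂ)] g₁)
    (h₂ : (f₂ : Lp ℂ 2 (volume.restrict (Ω : Set ℂ))) =ᵐ[volume.restrict (Ω : Set ℂ)] g₂) :
    inner ℂ f₁ f₂ = ∫ w in (Ω : Set ℂ), g₂ w * conj (g₁ w) := by
  rw [Submodule.coe_inner, L2.inner_def]
  refine integral_congr_ae ?_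
  filter_upwards [h₁, h₂] with w hw₁ hw₂
  rw [hw₁, hw₂, RCLike.inner_apply]

theorem restrictionOp_ae {U Ω : Opens ℂ} (h : U ≤ Ω) {f : bergmanSpace Ω} {g : ℂ → ℂ}
    (hf : (f : Lp ℂ 2 (volume.restrict (Ω : Set ℂ))) =ᵐ[volume.restrict (Ω : Set ℂ)] g) :
    (restrictionOp h f : Lp ℂ 2 (volume.restrict (U : Set ℂ)))
      =ᵐ[volume.restrict (U : Set ℂ)] g :=
  (restrictL2_ae (s := (U : Set ℂ)) (t := (Ω : Set ℂ)) h f.1).trans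
    (ae_restrict_of_ae_restrict_of_subset h hf)

theorem inner_toeplitzOp_eq {U Ω : Opens ℂ} (h : U ≤ Ω) {f₁ f₂ : bergmanSpace Ω} {g₁ g₂ : ℂ → ℂ}
    (h₁ : (f₁ : Lp ℂ 2 (volume.restrict (Ω : Set ℂ))) =ᵐ[volume.restrict (Ω : Set ℂ)] g₁)
    (h₂ : (f₂ : Lp ℂ 2 (volume.restrict (Ω : Set ℂ))) =ᵐ[volume.restrict (Ω : Set ℂ)] g₂) :
    inner ℂ f₁ (toeplitzOp h f₂) = ∫ w in (U : Set ℂ), g₂ w * conj (g₁ w) := by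
  rw [toeplitzOp, ContinuousLinearMap.comp_apply, ContinuousLinearMap.adjoint_inner_right]
  exact inner_bergmanSpace_eq (restrictionOp_ae h h₁) (restrictionOp_ae h h₂)

theorem toeplitzOp_nonneg {U Ω : Opens ℂ} (h : U ≤ Ω) : 0 ≤ toeplitzOp h :=
  (ContinuousLinearMap.nonneg_iff_isPositive _).2
    (ContinuousLinearMap.isPositive_adjoint_comp_self _)

theorem memLp_of_ae {Ω : Opens ℂ} {f : Lp ℂ 2 (volume.restrict (Ω : Set ℂ))} {g : ℂ → ℂ}
    (h : f =ᵐ[volume.restrict (Ω : Set ℂ)] g) : MemLp g 2 (volume.restrict (Ω : Set ℂ)) :=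
  (memLp_congr_ae h).1 (Lp.memLp f)

/-- The integrand of `⟨f₁, f₂⟩` is integrable. -/
theorem integrableOn_mul_conj {Ω : Opens ℂ} {f₁ f₂ : bergmanSpace Ω} {g₁ g₂ : ℂ → ℂ}
    (h₁ : (f₁ : Lp ℂ 2 (volume.restrict (Ω : Set ℂ))) =ᵐ[volume.restrict (Ω : Set ℂ)] g₁)
    (h₂ : (f₂ : Lp ℂ 2 (volume.restrict (Ω : Set ℂ))) =ᵐ[volume.restrict (Ω : Set ℂ)] g₂) :
    IntegrableOn (fun w => g₂ w * conj (g₁ w)) (Ω : Set ℂ) :=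
  (memLp_of_ae h₂).integrable_mul (memLp_of_ae h₁).star

/-- If `U` is up to a null set the disjoint union of `V` and `W`, then `T_U = T_V + T_W`. -/
theorem toeplitzOp_eq_add {U V W Ω : Opens ℂ} (hU : U ≤ Ω) (hV : V ≤ Ω) (hW : W ≤ Ω)
    (hdisj : Disjoint (V : Set ℂ) W) (hae : (U : Set ℂ) =ᵐ[volume] (V ∪ W : Set ℂ)) :
    toeplitzOp hU = toeplitzOp hV + toeplitzOp hW := by
  refine ContinuousLinearMap.ext fun f₂ => ext_inner_left ℂ fun f₁ => ?_
  obtain ⟨g₁, -, h₁⟩ := f₁.2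
  obtain ⟨g₂, -, h₂⟩ := f₂.2
  have hint := integrableOn_mul_conj h₁ h₂
  rw [add_apply, inner_add_right, inner_toeplitzOp_eq hU h₁ h₂,
    inner_toeplitzOp_eq hV h₁ h₂, inner_toeplitzOp_eq hW h₁ h₂, setIntegral_congr_set hae,
    setIntegral_union hdisj W.isOpen.measurableSet (hint.mono_set hV) (hint.mono_set hW)]

theorem toeplitzOp_mono {U V Ω : Opens ℂ} (hV : V ≤ Ω) (h : U ≤ V) :
    toeplitzOp (h.trans hV) ≤ toeplitzOp hV := by
  rw [ContinuousLinearMap.le_def, ContinuousLinearMap.isPositive_iff_complex]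
  intro f
  obtain ⟨g, -, hg⟩ := f.2
  have hint := integrableOn_mul_conj hg hg
  have hsq : ∀ w, g w * conj (g w) = ((‖g w‖ ^ 2 : ℝ) : ℂ) := fun w => by
    rw [Complex.mul_conj, Complex.normSq_eq_norm_sq]
  simp only [hsq] at hint
  have hre : IntegrableOn (fun w => ‖g w‖ ^ 2) (Ω : Set ℂ) := by
    exact hint.re
  have hkey : inner ℂ f ((toeplitzOp hV - toeplitzOp (h.trans hV)) f) =
      (((∫ w in (V : Set ℂ), ‖g w‖ ^ 2) - ∫ w in (U : Set ℂ), ‖g w‖ ^ 2 : ℝ) : ℂ) := by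
    rw [sub_apply, inner_sub_right, inner_toeplitzOp_eq hV hg hg,
      inner_toeplitzOp_eq (h.trans hV) hg hg]
    simp only [hsq]
    rw [integral_complex_ofReal, integral_complex_ofReal, Complex.ofReal_sub]
  rw [← inner_conj_symm, hkey]
  refine ⟨by simp, ?_⟩
  simp only [Complex.conj_ofReal, RCLike.re_to_complex, Complex.ofReal_re, sub_nonneg]
  exact setIntegral_mono_set (hre.mono_set hV) (ae_of_all _ fun w => by positivity)
    (LE.le.eventuallyLE h)

/-! ### The semigroup of horodiscs -/

/-- The horodisc at `ζ` of Euclidean radius `1 / (1 + s)`. The Cayley transform that sends `ζ` to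
`∞` maps it to the half-plane `{w | s < re w}`. -/
noncomputable def horodisc (ζ : ℂ) (s : ℝ) : Opens ℂ :=
  ⟨ball ((1 - (1 + s)⁻¹ : ℝ) * ζ) (1 + s)⁻¹, isOpen_ball⟩

theorem horodisc_zero (ζ : ℂ) : horodisc ζ 0 = unitDisc := by
  simp [horodisc, unitDisc]

theorem horodisc_anti {ζ : ℂ} (hζ : ‖ζ‖ = 1) {s t : ℝ} (hs : 0 ≤ s) (hst : s ≤ t) :
    horodisc ζ t ≤ horodisc ζ s := by
  refine ball_subset_ball' ?_
  have h1 : (1 + t)⁻¹ ≤ (1 + s)⁻¹ := inv_anti₀ (by positivity) (by linarith)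
  rw [dist_eq_norm, ← sub_mul, norm_mul, hζ, ← Complex.ofReal_sub, Complex.norm_real,
    Real.norm_of_nonneg (by linarith)]
  linarith

theorem horodisc_le {ζ : ℂ} (hζ : ‖ζ‖ = 1) {s : ℝ} (hs : 0 ≤ s) : horodisc ζ s ≤ unitDisc :=
  horodisc_zero ζ ▸ horodisc_anti hζ le_rfl hs

/-- The denominator of the Möbius transformation `horoMap ζ s`. -/
noncomputable def horoDenom (ζ : ℂ) (s : ℝ) (z : ℂ) : ℂ := 1 + s - s * conj ζ * z

/-- The parabolic Möbius transformation that is the translation `w ↦ w + 2 * s` of the right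
half-plane under the Cayley transform that sends `ζ` to `∞`. -/
noncomputable def horoMap (ζ : ℂ) (s : ℝ) (z : ℂ) : ℂ :=
  (s * ζ + (1 - s) * z) / horoDenom ζ s z

theorem norm_lt_norm_horoDenom {ζ : ℂ} (hζ : ‖ζ‖ = 1) {s : ℝ} (hs : 0 ≤ s) {z : ℂ}
    (hz : ‖z‖ < 1) : ‖z‖ < ‖horoDenom ζ s z‖ := by
  have h1 : ‖((1 + s : ℝ) : ℂ)‖ - ‖(s : ℂ) * conj ζ * z‖ ≤ ‖horoDenom ζ s z‖ := by
    refine (norm_sub_norm_le _ _).trans (le_of_eq ?_)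
    rw [horoDenom]; push_cast; rfl
  rw [norm_mul, norm_mul, RCLike.norm_conj, hζ, Complex.norm_real, Complex.norm_real,
    Real.norm_of_nonneg hs, Real.norm_of_nonneg (by positivity)] at h1
  nlinarith

theorem horoDenom_ne_zero {ζ : ℂ} (hζ : ‖ζ‖ = 1) {s : ℝ} (hs : 0 ≤ s) {z : ℂ}
    (hz : ‖z‖ < 1) : horoDenom ζ s z ≠ 0 :=
  norm_pos_iff.1 ((norm_nonneg z).trans_lt (norm_lt_norm_horoDenom hζ hs hz))

theorem mul_conj_eq_one {ζ : ℂ} (hζ : ‖ζ‖ = 1) : ζ * conj ζ = 1 := by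
  rw [Complex.mul_conj, Complex.normSq_eq_norm_sq, hζ]; simp

theorem horoMap_sub_center {ζ : ℂ} (hζ : ‖ζ‖ = 1) {s : ℝ} (hs : 0 ≤ s) {z : ℂ} (hz : ‖z‖ < 1) :
    horoMap ζ s z - (1 - (1 + s)⁻¹ : ℝ) * ζ = z / ((1 + s) * horoDenom ζ s z) := by
  have hD := horoDenom_ne_zero hζ hs hz
  have h1 : (1 + s : ℂ) ≠ 0 := by exact_mod_cast (by positivity : (1 + s) ≠ 0)
  rw [horoMap, eq_div_iff (mul_ne_zero h1 hD)]
  push_cast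
  field_simp
  rw [horoDenom]
  linear_combination (s : ℂ) ^ 2 * z * mul_conj_eq_one hζ

theorem horoMap_mem {ζ : ℂ} (hζ : ‖ζ‖ = 1) {s : ℝ} (hs : 0 ≤ s) {z : ℂ} (hz : ‖z‖ < 1) :
    horoMap ζ s z ∈ horodisc ζ s := by
  change horoMap ζ s z ∈ ball _ _
  have hD := norm_lt_norm_horoDenom hζ hs hz
  rw [mem_ball_iff_norm, horoMap_sub_center hζ hs hz, norm_div, norm_mul]
  have h1 : ‖(1 + s : ℂ)‖ = 1 + s := by
    rw [← Complex.ofReal_one, ← Complex.ofReal_add, Complex.norm_real,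
      Real.norm_of_nonneg (by positivity)]
  have h0 : 0 < ‖horoDenom ζ s z‖ := (norm_nonneg z).trans_lt hD
  rw [h1, div_lt_iff₀ (by positivity), inv_mul_cancel_left₀ (by positivity)]
  exact hD

theorem norm_horoMap_lt {ζ : ℂ} (hζ : ‖ζ‖ = 1) {s : ℝ} (hs : 0 ≤ s) {z : ℂ} (hz : ‖z‖ < 1) :
    ‖horoMap ζ s z‖ < 1 :=
  mem_ball_zero_iff.1 (horodisc_le hζ hs (horoMap_mem hζ hs hz))

theorem horoDenom_horoMap {ζ : ℂ} (hζ : ‖ζ‖ = 1) {s t : ℝ} (hs : 0 ≤ s) {z : ℂ} (hz : ‖z‖ < 1) :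
    horoDenom ζ s z * horoDenom ζ t (horoMap ζ s z) = horoDenom ζ (s + t) z := by
  have hD := horoDenom_ne_zero hζ hs hz
  rw [horoDenom.eq_1 ζ t, horoMap]
  field_simp
  simp only [horoDenom]
  push_cast
  linear_combination -(s * t : ℂ) * mul_conj_eq_one hζ

theorem horoMap_horoMap {ζ : ℂ} (hζ : ‖ζ‖ = 1) {s t : ℝ} (hs : 0 ≤ s) (ht : 0 ≤ t) {z : ℂ}
    (hz : ‖z‖ < 1) : horoMap ζ t (horoMap ζ s z) = horoMap ζ (s + t) z := by
  have hD := horoDenom_ne_zero hζ hs hz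
  have hD' := horoDenom_ne_zero hζ ht (norm_horoMap_lt hζ hs hz)
  rw [horoMap.eq_1 ζ (s + t), horoMap.eq_1 ζ t, ← horoDenom_horoMap hζ hs hz,
    div_eq_div_iff hD' (mul_ne_zero hD hD')]
  have : horoMap ζ s z * horoDenom ζ s z = s * ζ + (1 - s) * z := div_mul_cancel₀ _ hD
  have h2 : horoDenom ζ s z = 1 + s - s * conj ζ * z := rfl
  push_cast
  linear_combination (horoDenom ζ t (horoMap ζ s z)) * ((1 - t) * this + t * ζ * h2
    - (s * t : ℂ) * z * mul_conj_eq_one hζ)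

/-- Restricted to a horodisc, the Bergman kernel of the unit disc is a multiple of the Bergman
kernel of the horodisc, with pole moved by `horoMap`. -/
theorem discKernel_horodisc {ζ : ℂ} (hζ : ‖ζ‖ = 1) {s : ℝ} (hs : 0 ≤ s) {z w : ℂ} (hz : ‖z‖ < 1)
    (hw : w ∈ unitDisc) :
    discKernel 0 1 z w = (horoDenom ζ s z ^ 2)⁻¹ *
      discKernel ((1 - (1 + s)⁻¹ : ℝ) * ζ) (1 + s)⁻¹ (horoMap ζ s z) w := by
  have hD := horoDenom_ne_zero hζ hs hz
  have h1 : (1 + s : ℂ) ≠ 0 := by exact_mod_cast (by positivity : (1 + s) ≠ 0)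
  have hw1 : 1 - z * conj w ≠ 0 := by
    have := sq_sub_mul_conj_ne_zero hz (mem_ball_zero_iff.1 hw).le
    simpa using this
  have hpi : (Real.pi : ℂ) ≠ 0 := by exact_mod_cast Real.pi_ne_zero
  have hk : (((1 + s)⁻¹ : ℝ) : ℂ) ^ 2 - (horoMap ζ s z - (1 - (1 + s)⁻¹ : ℝ) * ζ) *
      conj (w - (1 - (1 + s)⁻¹ : ℝ) * ζ) = (1 - z * conj w) / ((1 + s) * horoDenom ζ s z) := by
    rw [horoMap_sub_center hζ hs hz, map_sub, map_mul, Complex.conj_ofReal]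
    push_cast
    field_simp
    rw [horoDenom]
    ring
  rw [discKernel, discKernel, hk]
  push_cast
  simp only [sub_zero, one_pow]
  field_simp

/-- Bounded holomorphic functions on the unit disc belong to the Bergman space. -/
theorem exists_bergmanSpace_ae {g : ℂ → ℂ} (hg : DifferentiableOn ℂ g (ball 0 1)) {C : ℝ}
    (hC : ∀ z ∈ ball (0 : ℂ) 1, ‖g z‖ ≤ C) : ∃ f : bergmanSpace unitDisc,
      (f : Lp ℂ 2 (volume.restrict (unitDisc : Set ℂ))) =ᵐ[volume.restrict (unitDisc : Set ℂ)]
        g := by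
  have hfin : IsFiniteMeasure (volume.restrict (unitDisc : Set ℂ)) :=
    ⟨by rw [Measure.restrict_apply_univ]; exact measure_ball_lt_top⟩
  have hm : AEStronglyMeasurable g (volume.restrict (unitDisc : Set ℂ)) :=
    hg.continuousOn.aestronglyMeasurable measurableSet_ball
  have hL : MemLp g 2 (volume.restrict (unitDisc : Set ℂ)) := by
    refine MemLp.of_bound hm C ?_
    filter_upwards [ae_restrict_mem unitDisc.isOpen.measurableSet] with z hz
    exact hC z hz
  exact ⟨⟨hL.toLp g, g, hg, hL.coeFn_toLp⟩, hL.coeFn_toLp⟩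

theorem integrableOn_of_memLp {c : ℂ} {R : ℝ} {g : ℂ → ℂ}
    (hg : MemLp g 2 (volume.restrict (ball c R))) : IntegrableOn g (ball c R) := by
  have hfin : IsFiniteMeasure (volume.restrict (ball c R)) :=
    ⟨by rw [Measure.restrict_apply_univ]; exact measure_ball_lt_top⟩
  exact hg.integrable (by norm_num)

/-- The Bergman kernel with pole `z`, in its holomorphic variable, belongs to the Bergman space. -/
theorem exists_discKernel_ae {z : ℂ} (hz : ‖z‖ < 1) : ∃ k : bergmanSpace unitDisc,
      (k : Lp ℂ 2 (volume.restrict (unitDisc : Set ℂ))) =ᵐ[volume.restrict (unitDisc : Set ℂ)]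
        fun w => conj (discKernel 0 1 z w) := by
  have hz' : z ∈ ball (0 : ℂ) 1 := mem_ball_zero_iff.2 hz
  obtain ⟨C, hC⟩ := (isCompact_closedBall (0 : ℂ) 1).exists_bound_of_continuousOn
    (continuousOn_discKernel hz')
  refine exists_bergmanSpace_ae ?_ (C := C) fun w hw => ?_
  · have h : (fun w => conj (discKernel 0 1 z w)) =
        fun w => 1 / (Real.pi * (1 - conj z * w) ^ 2) := by
      ext w; simp [discKernel]
    rw [h]
    refine DifferentiableOn.div (by fun_prop) (by fun_prop) fun w hw => ?_
    refine mul_ne_zero (by exact_mod_cast Real.pi_ne_zero) (pow_ne_zero 2 ?_)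
    have := sq_sub_mul_conj_ne_zero (z := w) (w := z) (mem_ball_zero_iff.1 hw) hz.le
    simpa [mul_comm] using this
  · rw [RCLike.norm_conj]
    exact hC w (ball_subset_closedBall hw)

/-- In the half-plane picture the Toeplitz operator of the horodisc is the translation
`f ↦ f (· + 2 * s)`; the factor `(horoDenom ζ s z ^ 2)⁻¹` is the derivative of `horoMap ζ s`. -/
theorem toeplitzOp_horodisc_apply {ζ : ℂ} (hζ : ‖ζ‖ = 1) {s : ℝ} (hs : 0 ≤ s)
    {f : bergmanSpace unitDisc} {g G : ℂ → ℂ} (hg : DifferentiableOn ℂ g unitDisc)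
    (hG : DifferentiableOn ℂ G unitDisc)
    (hf : (f : Lp ℂ 2 (volume.restrict (unitDisc : Set ℂ)))
      =ᵐ[volume.restrict (unitDisc : Set ℂ)] g)
    (hT : (toeplitzOp (horodisc_le hζ hs) f : Lp ℂ 2 (volume.restrict (unitDisc : Set ℂ)))
      =ᵐ[volume.restrict (unitDisc : Set ℂ)] G) {z : ℂ} (hz : ‖z‖ < 1) :
    G z = (horoDenom ζ s z ^ 2)⁻¹ * g (horoMap ζ s z) := by
  have hz' : z ∈ ball (0 : ℂ) 1 := mem_ball_zero_iff.2 hz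
  obtain ⟨k, hk⟩ := exists_discKernel_ae hz
  have h1 := inner_bergmanSpace_eq hk hT
  have h2 := inner_toeplitzOp_eq (horodisc_le hζ hs) hk hf
  simp only [Complex.conj_conj] at h1 h2
  have h3 : ∫ w in ball 0 1, G w * discKernel 0 1 z w = G z :=
    integral_mul_discKernel hG (integrableOn_of_memLp (memLp_of_ae hT)) hz'
  have hsub : (horodisc ζ s : Set ℂ) ⊆ unitDisc := horodisc_le hζ hs
  rw [← h3]
  refine h1.symm.trans (h2.trans ?_)
  have h4 : ∀ w ∈ (horodisc ζ s : Set ℂ), g w * discKernel 0 1 z w = (horoDenom ζ s z ^ 2)⁻¹ *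
      (g w * discKernel ((1 - (1 + s)⁻¹ : ℝ) * ζ) (1 + s)⁻¹ (horoMap ζ s z) w) := fun w hw => by
    rw [discKernel_horodisc hζ hs hz (hsub hw)]; ring
  rw [setIntegral_congr_fun (horodisc ζ s).isOpen.measurableSet h4, integral_const_mul]
  congr 1
  exact integral_mul_discKernel (hg.mono hsub)
    ((integrableOn_of_memLp (memLp_of_ae hf)).mono_set hsub) (horoMap_mem hζ hs hz)

/-- An element of the Bergman space is determined by the values of a representative on `Ω`. -/
theorem bergmanSpace_ext {Ω : Opens ℂ} {f₁ f₂ : bergmanSpace Ω} {g₁ g₂ : ℂ → ℂ}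
    (h₁ : (f₁ : Lp ℂ 2 (volume.restrict (Ω : Set ℂ))) =ᵐ[volume.restrict (Ω : Set ℂ)] g₁)
    (h₂ : (f₂ : Lp ℂ 2 (volume.restrict (Ω : Set ℂ))) =ᵐ[volume.restrict (Ω : Set ℂ)] g₂)
    (h : ∀ z ∈ Ω, g₁ z = g₂ z) : f₁ = f₂ := by
  refine Subtype.ext (Lp.ext (h₁.trans (EventuallyEq.trans ?_ h₂.symm)))
  filter_upwards [ae_restrict_mem Ω.isOpen.measurableSet] with z hz using h z hz

theorem toeplitzOp_horodisc_zero {ζ : ℂ} (hζ : ‖ζ‖ = 1) :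
    toeplitzOp (horodisc_le hζ le_rfl) = 1 := by
  refine ContinuousLinearMap.ext fun f => ?_
  obtain ⟨g, hg, hf⟩ := f.2
  obtain ⟨G, hG, hT⟩ := (toeplitzOp (horodisc_le hζ le_rfl) f).2
  refine bergmanSpace_ext hT hf fun z hz => ?_
  rw [toeplitzOp_horodisc_apply hζ le_rfl hg hG hf hT (mem_ball_zero_iff.1 hz)]
  simp [horoDenom, horoMap]

theorem toeplitzOp_horodisc_add {ζ : ℂ} (hζ : ‖ζ‖ = 1) {s t : ℝ} (hs : 0 ≤ s) (ht : 0 ≤ t) :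
    toeplitzOp (horodisc_le hζ (add_nonneg hs ht)) =
      toeplitzOp (horodisc_le hζ hs) * toeplitzOp (horodisc_le hζ ht) := by
  refine ContinuousLinearMap.ext fun f => ?_
  rw [mul_apply_eq_comp]
  obtain ⟨g, hg, hf⟩ := f.2
  obtain ⟨G, hG, hT⟩ := (toeplitzOp (horodisc_le hζ (add_nonneg hs ht)) f).2
  obtain ⟨G₁, hG₁, hT₁⟩ := (toeplitzOp (horodisc_le hζ ht) f).2
  obtain ⟨G₂, hG₂, hT₂⟩ :=
    (toeplitzOp (horodisc_le hζ hs) (toeplitzOp (horodisc_le hζ ht) f)).2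
  refine bergmanSpace_ext hT hT₂ fun z hz => ?_
  have hz : ‖z‖ < 1 := mem_ball_zero_iff.1 hz
  rw [toeplitzOp_horodisc_apply hζ (add_nonneg hs ht) hg hG hf hT hz,
    toeplitzOp_horodisc_apply hζ hs hG₁ hG₂ hT₁ hT₂ hz,
    toeplitzOp_horodisc_apply hζ ht hg hG₁ hf hT₁ (norm_horoMap_lt hζ hs hz),
    horoMap_horoMap hζ hs ht hz, ← horoDenom_horoMap hζ hs hz]
  ring

/-- For the constant function `e = 1`, the number `⟨e, T_U e⟩` is the area of `U`. -/
theorem exists_inner_toeplitzOp_horodisc : ∃ e : bergmanSpace unitDisc, ∀ (ζ : ℂ) (hζ : ‖ζ‖ = 1)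
    (s : ℝ) (hs : 0 ≤ s),
    inner ℂ e (toeplitzOp (horodisc_le hζ hs) e) = ((Real.pi * (1 / (1 + s)) ^ 2 : ℝ) : ℂ) := by
  obtain ⟨e, he⟩ := exists_bergmanSpace_ae (g := fun _ => 1) (C := 1) (differentiableOn_const 1)
    (by simp)
  refine ⟨e, fun ζ hζ s hs => ?_⟩
  rw [inner_toeplitzOp_eq _ he he]
  have : volume.real (horodisc ζ s : Set ℂ) = Real.pi * (1 / (1 + s)) ^ 2 := by
    change volume.real (ball _ _) = _
    rw [Measure.real, Complex.volume_ball, ENNReal.toReal_mul, ENNReal.toReal_pow,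
      ENNReal.toReal_ofReal (by positivity)]
    simp [mul_comm]
  rw [← this]
  simp

/-! ### The range of `x - x ^ α` -/

theorem image_sub_rpow_Icc {α : ℝ} (hα : 1 < α) :
    (fun x : ℝ => x - x ^ α) '' Icc 0 1 =
      Icc 0 (α ^ (-(1 / (α - 1))) - α ^ (-(α / (α - 1)))) := by
  have hα0 : 0 < α := by linarith
  have hα1 : 0 < α - 1 := by linarith
  -- the critical point of `x - x ^ α`
  set x₀ : ℝ := α ^ (-(1 / (α - 1))) with hx₀
  have hx₀p : 0 < x₀ := Real.rpow_pos_of_pos hα0 _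
  have hx₀1 : x₀ ≤ 1 :=
    Real.rpow_le_one_of_one_le_of_nonpos hα.le (neg_nonpos.2 (by positivity))
  have hpow : x₀ ^ α = α ^ (-(α / (α - 1))) := by
    rw [hx₀, ← Real.rpow_mul hα0.le]; congr 1; ring
  have hdiv : x₀ ^ α = x₀ / α := by
    rw [hpow, hx₀, ← Real.rpow_sub_one hα0.ne']; congr 1; field_simp; ring
  rw [← hpow]
  have hc : Continuous fun x : ℝ => x - x ^ α :=
    continuous_id.sub (Real.continuous_rpow_const hα0.le)
  refine Subset.antisymm ?_ ?_
  · rintro _ ⟨x, ⟨hx0, hx1⟩, rfl⟩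
    refine ⟨sub_nonneg.2 ?_, ?_⟩
    · simpa using Real.rpow_le_rpow_of_exponent_ge' hx0 hx1 zero_le_one hα.le
    · -- Bernoulli's inequality at `x / x₀`
      have hb := one_add_mul_self_le_rpow_one_add (s := x / x₀ - 1)
        (by have : 0 ≤ x / x₀ := by positivity
            linarith) hα.le
      rw [add_sub_cancel, Real.div_rpow hx0 hx₀p.le, le_div_iff₀ (by positivity), hdiv] at hb
      have e : (1 + α * (x / x₀ - 1)) * (x₀ / α) = x₀ / α + x - x₀ := by field_simp; ring
      simp only
      rw [hdiv]
      linarith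
  · have h := intermediate_value_Icc hx₀p.le hc.continuousOn
    rw [Real.zero_rpow hα0.ne', sub_zero] at h
    exact h.trans (image_mono (Icc_subset_Icc_right hx₀1))

/-! ### Spectra in decreasing semigroups of positive contractions -/

section Semigroup

variable {H : Type*} [NormedAddCommGroup H] [InnerProductSpace ℂ H] [CompleteSpace H]

/-- The moments of `t * exp (-t) dt` under `t ↦ exp (-(s * t))`. -/
theorem integral_exp_pow_mul {s : ℝ} (hs : 0 ≤ s) (n : ℕ) :
    ∫ t in Ioi (0 : ℝ), Real.exp (-(s * t)) ^ n * (t * Real.exp (-t)) =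
      (1 / (1 + n * s)) ^ 2 := by
  have hpos : 0 < 1 + n * s := by positivity
  have h := Real.integral_rpow_mul_exp_neg_mul_Ioi (a := 2) two_pos hpos
  rw [Real.Gamma_two, mul_one, Real.rpow_two] at h
  rw [← h]
  refine setIntegral_congr_fun measurableSet_Ioi fun t _ => ?_
  norm_num
  rw [← Real.exp_nat_mul, mul_left_comm, ← Real.exp_add]
  congr 2
  ring

theorem integrableOn_mul_exp_neg : IntegrableOn (fun t : ℝ => t * Real.exp (-t)) (Ioi 0) := by
  have h := Real.GammaIntegral_convergent (s := 2) two_pos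
  refine h.congr_fun (fun t _ => ?_) measurableSet_Ioi
  norm_num [mul_comm]

theorem integral_mul_exp_neg : ∫ t in Ioi (0 : ℝ), t * Real.exp (-t) = 1 := by
  simpa using integral_exp_pow_mul le_rfl 0

theorem exp_neg_mul_mem_Icc {s t : ℝ} (hs : 0 ≤ s) (ht : 0 ≤ t) :
    Real.exp (-(s * t)) ∈ Icc (0 : ℝ) 1 :=
  ⟨(Real.exp_pos _).le, Real.exp_le_one_iff.2 (by have := mul_nonneg hs ht; linarith)⟩

theorem integrableOn_comp_exp_mul {s : ℝ} (hs : 0 ≤ s) {f : ℝ → ℝ} (hf : Continuous f) :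
    IntegrableOn (fun t => f (Real.exp (-(s * t))) * (t * Real.exp (-t))) (Ioi 0) := by
  obtain ⟨C, hC⟩ := (isCompact_Icc (a := (0 : ℝ)) (b := 1)).exists_bound_of_continuousOn
    hf.continuousOn
  refine Integrable.bdd_mul (c := C) integrableOn_mul_exp_neg
    (by fun_prop : Continuous fun t => f (Real.exp (-(s * t)))).aestronglyMeasurable ?_
  filter_upwards [ae_restrict_mem measurableSet_Ioi] with t ht
  exact hC _ (exp_neg_mul_mem_Icc hs (le_of_lt ht))

theorem spectrum_subset_Icc {A : H →L[ℂ] H} (h0 : 0 ≤ A) (h1 : A ≤ 1) :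
    spectrum ℝ A ⊆ Icc 0 1 := fun x hx =>
  ⟨spectrum_nonneg_of_nonneg h0 hx,
    (CFC.le_one_iff (R := ℝ) A (IsSelfAdjoint.of_nonneg h0)).1 h1 x hx⟩

/-- If the moments `⟨e, A ^ n e⟩` of a positive contraction are those of the image of the measure
`c * t * exp (-t) dt` on `(0, ∞)` under `t ↦ exp (-(s * t))`, then by Weierstrass this image is the
spectral measure of `A` at `e`. -/
theorem inner_cfc_eq_integral {A : H →L[ℂ] H} {e : H} {s c : ℝ} (hs : 0 ≤ s) (h0 : 0 ≤ A)
    (h1 : A ≤ 1)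
    (hmom : ∀ n : ℕ, inner ℂ e ((A ^ n) e) = ((c * (1 / (1 + n * s)) ^ 2 : ℝ) : ℂ))
    {f : ℝ → ℝ} (hf : Continuous f) :
    inner ℂ e (cfc f A e) =
      ((c * ∫ t in Ioi (0 : ℝ), f (Real.exp (-(s * t))) * (t * Real.exp (-t)) : ℝ) : ℂ) := by
  have hsa : IsSelfAdjoint A := IsSelfAdjoint.of_nonneg h0
  have hpoly : ∀ p : Polynomial ℝ, inner ℂ e (cfc (fun x => p.eval x) A e) =
      ((c * ∫ t in Ioi (0 : ℝ), p.eval (Real.exp (-(s * t))) * (t * Real.exp (-t)) : ℝ) : ℂ) := by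
    intro p
    rw [cfc_polynomial p A hsa]
    induction p using Polynomial.induction_on' with
    | add p q hp hq =>
      have hi := integrableOn_comp_exp_mul hs p.continuous
      have hj := integrableOn_comp_exp_mul hs q.continuous
      rw [map_add, add_apply, inner_add_right, hp, hq, ← Complex.ofReal_add,
        ← mul_add, ← integral_add hi hj]
      simp only [Polynomial.eval_add, add_mul]
    | monomial n a =>
      have := integral_exp_pow_mul hs n
      simp only [Polynomial.eval_monomial, mul_assoc, integral_const_mul]
      rw [this, Polynomial.aeval_monomial, ← Algebra.smul_def, smul_apply, ← Complex.coe_smul,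
        inner_smul_right, hmom]
      push_cast
      ring
  rw [← sub_eq_zero, ← norm_le_zero_iff]
  refine le_of_forall_pos_le_add fun ε hε => ?_
  rw [zero_add]
  obtain ⟨p, hp⟩ := exists_polynomial_near_of_continuousOn 0 1 f hf.continuousOn
    (ε / (‖e‖ ^ 2 + |c| + 1)) (by positivity)
  set δ := ε / (‖e‖ ^ 2 + |c| + 1) with hδ
  have hδ0 : 0 < δ := by positivity
  have hb1 : ‖inner ℂ e (cfc f A e) - inner ℂ e (cfc (fun x => p.eval x) A e)‖
      ≤ δ * ‖e‖ ^ 2 := by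
    rw [← inner_sub_right, ← sub_apply, ← cfc_sub f _ A (by fun_prop) (by fun_prop)]
    have hn : ‖cfc (fun x => f x - p.eval x) A‖ ≤ δ := by
      refine norm_cfc_le hδ0.le fun x hx => ?_
      rw [Real.norm_eq_abs, abs_sub_comm]
      exact (hp x (spectrum_subset_Icc h0 h1 hx)).le
    calc _ ≤ ‖e‖ * ‖cfc (fun x => f x - p.eval x) A e‖ := norm_inner_le_norm _ _
      _ ≤ ‖e‖ * (δ * ‖e‖) := by
        gcongr
        exact (ContinuousLinearMap.le_opNorm _ _).trans (by gcongr)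
      _ = δ * ‖e‖ ^ 2 := by ring
  have hb2 : |(∫ t in Ioi (0 : ℝ), f (Real.exp (-(s * t))) * (t * Real.exp (-t))) -
      ∫ t in Ioi (0 : ℝ), p.eval (Real.exp (-(s * t))) * (t * Real.exp (-t))| ≤ δ := by
    rw [← integral_sub (integrableOn_comp_exp_mul hs hf)
      (integrableOn_comp_exp_mul hs p.continuous)]
    have hδi : ∫ t in Ioi (0 : ℝ), δ * (t * Real.exp (-t)) = δ := by
      rw [integral_const_mul, integral_mul_exp_neg, mul_one]
    rw [← Real.norm_eq_abs]
    refine (norm_integral_le_of_norm_le (integrableOn_mul_exp_neg.const_mul δ) ?_).trans hδi.le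
    filter_upwards [ae_restrict_mem measurableSet_Ioi] with t ht
    have ht' : 0 < t := ht
    rw [← sub_mul, norm_mul, Real.norm_eq_abs, Real.norm_of_nonneg (by positivity), abs_sub_comm]
    gcongr
    exact (hp _ (exp_neg_mul_mem_Icc hs ht'.le)).le
  have hb3 : ‖inner ℂ e (cfc (fun x => p.eval x) A e) -
      ((c * ∫ t in Ioi (0 : ℝ), f (Real.exp (-(s * t))) * (t * Real.exp (-t)) : ℝ) : ℂ)‖
        ≤ |c| * δ := by
    rw [hpoly, ← Complex.ofReal_sub, Complex.norm_real, ← mul_sub, norm_mul, Real.norm_eq_abs,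
      Real.norm_eq_abs, abs_sub_comm]
    gcongr
  calc _ ≤ _ := norm_sub_le_norm_sub_add_norm_sub _
          (inner ℂ e (cfc (fun x => p.eval x) A e)) _
    _ ≤ δ * ‖e‖ ^ 2 + |c| * δ := add_le_add hb1 hb3
    _ ≤ δ * (‖e‖ ^ 2 + |c| + 1) := by linarith
    _ = ε := by rw [hδ]; field_simp

/-- The spectral measure in `inner_cfc_eq_integral` has support `[0, 1]`: a bump function supported
in a gap of the spectrum would have integral zero. -/
theorem spectrum_eq_Icc_of_moments {A : H →L[ℂ] H} {e : H} {s c : ℝ} (hs : 0 < s) (hc : 0 < c)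
    (h0 : 0 ≤ A) (h1 : A ≤ 1)
    (hmom : ∀ n : ℕ, inner ℂ e ((A ^ n) e) = ((c * (1 / (1 + n * s)) ^ 2 : ℝ) : ℂ)) :
    spectrum ℝ A = Icc 0 1 := by
  refine (spectrum_subset_Icc h0 h1).antisymm ?_
  have hclosed : IsClosed (spectrum ℝ A) := spectrum.isClosed A
  have hIoo : Ioo (0 : ℝ) 1 ⊆ spectrum ℝ A := by
    intro x hx
    by_contra hxs
    obtain ⟨ε, hε, hball⟩ := Metric.isOpen_iff.1 hclosed.isOpen_compl x hxs
    set f : ℝ → ℝ := fun y => max 0 (ε - |y - x|) with hf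
    have hfc : Continuous f := by fun_prop
    have hfs : cfc f A = 0 := by
      rw [← cfc_zero ℝ A]
      refine cfc_congr fun y hy => max_eq_left ?_
      have : y ∉ ball x ε := fun h => hball h hy
      rw [mem_ball, Real.dist_eq] at this
      linarith
    have h := inner_cfc_eq_integral hs.le h0 h1 hmom hfc
    rw [hfs, zero_apply, inner_zero_right] at h
    have h' := (mul_eq_zero.1 (Complex.ofReal_eq_zero.1 h.symm)).resolve_left hc.ne'
    refine h'.not_gt ?_
    have hnn : ∀ᵐ t ∂volume.restrict (Ioi (0 : ℝ)),
        0 ≤ f (Real.exp (-(s * t))) * (t * Real.exp (-t)) := by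
      filter_upwards [ae_restrict_mem measurableSet_Ioi] with t ht
      have ht' : 0 < t := ht
      exact mul_nonneg (le_max_left _ _) (by positivity)
    rw [setIntegral_pos_iff_support_of_nonneg_ae hnn (integrableOn_comp_exp_mul hs.le hfc)]
    have hopen : IsOpen (Function.support
        (fun t => f (Real.exp (-(s * t))) * (t * Real.exp (-t))) ∩ Ioi 0) :=
      (Continuous.isOpen_support (by fun_prop)).inter isOpen_Ioi
    refine hopen.measure_pos _ ⟨-Real.log x / s, ?_, ?_⟩
    · have h2 : Real.exp (-(s * (-Real.log x / s))) = x := by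
        rw [mul_div_cancel₀ _ hs.ne', neg_neg, Real.exp_log hx.1]
      have h3 : f x = ε := by simp [hf, hε.le]
      rw [Function.mem_support, h2, h3]
      exact mul_ne_zero hε.ne' (mul_ne_zero
        (div_ne_zero (neg_ne_zero.2 (Real.log_neg hx.1 hx.2).ne) hs.ne') (Real.exp_pos _).ne')
    · exact div_pos (neg_pos.2 (Real.log_neg hx.1 hx.2)) hs
  rw [← closure_Ioo (zero_ne_one' ℝ)]
  exact closure_minimal hIoo hclosed

omit [CompleteSpace H] in
theorem semigroup_natCast_mul {T : ℝ → H →L[ℂ] H} (hT0 : T 0 = 1)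
    (hadd : ∀ s t, 0 ≤ s → 0 ≤ t → T (s + t) = T s * T t) {s : ℝ} (hs : 0 ≤ s) (n : ℕ) :
    T (n * s) = T s ^ n := by
  induction n with
  | zero => simp [hT0]
  | succ n ih => rw [pow_succ, ← ih, ← hadd _ _ (by positivity) hs]; congr 1; push_cast; ring

theorem tendsto_rpow_of_spectrum_subset_Icc {A : H →L[ℂ] H} (h0 : 0 ≤ A) (h1 : A ≤ 1) {α : ℝ}
    (hα : 0 < α) : Tendsto (fun p : ℝ => A ^ p) (𝓝 α) (𝓝 (A ^ α)) := by
  have hev : ∀ᶠ p : ℝ in 𝓝 α, 0 < p := lt_mem_nhds hα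
  simp only [CFC.rpow_eq_cfc_real h0]
  refine tendsto_cfc_fun ?_ ?_
  · have hcont : ContinuousOn (Function.uncurry fun p x : ℝ => x ^ p) (Ioi 0 ×ˢ Icc 0 1) := by
      rintro ⟨p, x⟩ ⟨hp, -⟩
      exact (ContinuousAt.comp (f := Prod.swap) (x := (p, x))
        (Real.continuousAt_rpow_of_pos (x, p) hp) continuous_swap.continuousAt).continuousWithinAt
    intro u hu
    obtain ⟨v, hv, hv'⟩ := isCompact_Icc.mem_uniformity_of_prod hcont hα (symm_le_uniformity hu)
    rw [nhdsWithin_eq_nhds.2 (Ioi_mem_nhds hα)] at hv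
    filter_upwards [hv] with p hp x hx
    exact hv' p hp x (spectrum_subset_Icc h0 h1 hx)
  · filter_upwards [hev] with p hp
    exact (Real.continuous_rpow_const hp.le).continuousOn

/-- In a decreasing semigroup of positive contractions the operators are the powers of any one of
them: for rational exponents by uniqueness of positive roots, and in general by monotonicity. -/
theorem semigroup_mul_eq_rpow {T : ℝ → H →L[ℂ] H} (hT0 : T 0 = 1)
    (hadd : ∀ s t, 0 ≤ s → 0 ≤ t → T (s + t) = T s * T t)
    (hpos : ∀ s, 0 ≤ s → 0 ≤ T s) (hanti : ∀ s t, 0 ≤ s → s ≤ t → T t ≤ T s)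
    {s α : ℝ} (hs : 0 ≤ s) (hα : 0 < α) : T (α * s) = T s ^ α := by
  have h0 := hpos s hs
  have h1 : T s ≤ 1 := hT0 ▸ hanti 0 s le_rfl hs
  have hrat : ∀ q : ℚ, 0 < q → T ((q : ℝ) * s) = T s ^ (q : ℝ) := by
    intro q hq
    have hd : (q.den : ℝ) ≠ 0 := by exact_mod_cast q.den_ne_zero
    have hq0 : (0 : ℝ) ≤ q := by exact_mod_cast hq.le
    have hnum : (q.num.toNat : ℝ) = q * q.den := by
      have : ((q.num.toNat : ℤ) : ℚ) = q * q.den := by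
        rw [Int.toNat_of_nonneg (Rat.num_nonneg.2 hq.le), Rat.mul_den_eq_num]
      exact_mod_cast this
    have hq' := hpos (q * s) (by positivity)
    -- both `T (q * s)` and `T s ^ q` are positive roots of order `q.den` of `T s ^ q.num`
    have h2 : T (q * s) ^ q.den = T s ^ q.num.toNat := by
      rw [← semigroup_natCast_mul hT0 hadd (by positivity), ← semigroup_natCast_mul hT0 hadd hs,
        hnum]
      congr 1; ring
    rw [← CFC.rpow_natCast _ _ hq', ← CFC.rpow_natCast _ _ h0] at h2
    have h3 := congrArg (fun B : H →L[ℂ] H => B ^ ((q.den : ℝ)⁻¹)) h2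
    beta_reduce at h3
    rw [CFC.rpow_rpow_of_exponent_nonneg _ _ _ (by positivity) (by positivity) hq',
      CFC.rpow_rpow_of_exponent_nonneg _ _ _ (by positivity) (by positivity) h0, hnum,
      mul_inv_cancel₀ hd, CFC.rpow_one _ hq', mul_inv_cancel_right₀ hd] at h3
    exact h3
  have hlim := tendsto_rpow_of_spectrum_subset_Icc h0 h1 hα
  refine le_antisymm ?_ ?_
  · obtain ⟨u, -, hu, hlu⟩ := Real.exists_seq_rat_strictMono_tendsto α
    refine ge_of_tendsto (hlim.comp hlu) ?_
    filter_upwards [hlu.eventually (lt_mem_nhds hα)] with n hn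
    have hn' : (0 : ℚ) < u n := by exact_mod_cast hn
    rw [Function.comp, ← hrat _ hn']
    exact hanti _ _ (by positivity) (by gcongr; exact (hu n).le)
  · obtain ⟨u, -, hu, hlu⟩ := Real.exists_seq_rat_strictAnti_tendsto α
    refine le_of_tendsto (hlim.comp hlu) (Eventually.of_forall fun n => ?_)
    have hn : (0 : ℝ) < u n := hα.trans (hu n)
    have hn' : (0 : ℚ) < u n := by exact_mod_cast hn
    rw [Function.comp, ← hrat _ hn']
    exact hanti _ _ (by positivity) (by gcongr; exact (hu n).le)

theorem spectrum_complex_eq_of_nonneg {A : H →L[ℂ] H} (hA : 0 ≤ A) :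
    spectrum ℂ A = (fun x : ℝ => (x : ℂ)) '' spectrum ℝ A :=
  (IsSelfAdjoint.of_nonneg hA).spectrumRestricts.algebraMap_image.symm

theorem spectrum_semigroup {T : ℝ → H →L[ℂ] H} (hT0 : T 0 = 1)
    (hadd : ∀ s t, 0 ≤ s → 0 ≤ t → T (s + t) = T s * T t)
    (hpos : ∀ s, 0 ≤ s → 0 ≤ T s) (hanti : ∀ s t, 0 ≤ s → s ≤ t → T t ≤ T s)
    {e : H} {c : ℝ} (hc : 0 < c)
    (he : ∀ s, 0 ≤ s → inner ℂ e (T s e) = ((c * (1 / (1 + s)) ^ 2 : ℝ) : ℂ))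
    {s : ℝ} (hs : 0 < s) : spectrum ℝ (T s) = Icc 0 1 := by
  refine spectrum_eq_Icc_of_moments (e := e) hs hc (hpos s hs.le)
    (hT0 ▸ hanti 0 s le_rfl hs.le) fun n => ?_
  rw [← semigroup_natCast_mul hT0 hadd hs.le, he _ (by positivity)]

theorem spectrum_complex_semigroup {T : ℝ → H →L[ℂ] H} (hT0 : T 0 = 1)
    (hadd : ∀ s t, 0 ≤ s → 0 ≤ t → T (s + t) = T s * T t)
    (hpos : ∀ s, 0 ≤ s → 0 ≤ T s) (hanti : ∀ s t, 0 ≤ s → s ≤ t → T t ≤ T s)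
    {e : H} {c : ℝ} (hc : 0 < c)
    (he : ∀ s, 0 ≤ s → inner ℂ e (T s e) = ((c * (1 / (1 + s)) ^ 2 : ℝ) : ℂ))
    {s : ℝ} (hs : 0 < s) :
    spectrum ℂ (T s) = (fun x : ℝ => (x : ℂ)) '' Icc 0 1 := by
  rw [spectrum_complex_eq_of_nonneg (hpos s hs.le),
    spectrum_semigroup hT0 hadd hpos hanti hc he hs]

/-- The difference `T s - T t` equals `T s - (T s) ^ (t / s)`, so that the spectral mapping theorem
gives its spectrum. -/
theorem spectrum_complex_semigroup_sub {T : ℝ → H →L[ℂ] H} (hT0 : T 0 = 1)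
    (hadd : ∀ s t, 0 ≤ s → 0 ≤ t → T (s + t) = T s * T t)
    (hpos : ∀ s, 0 ≤ s → 0 ≤ T s) (hanti : ∀ s t, 0 ≤ s → s ≤ t → T t ≤ T s)
    {e : H} {c : ℝ} (hc : 0 < c)
    (he : ∀ s, 0 ≤ s → inner ℂ e (T s e) = ((c * (1 / (1 + s)) ^ 2 : ℝ) : ℂ))
    {s t α : ℝ} (hs : 0 < s) (hst : s < t) (hα : α = t / s) :
    spectrum ℂ (T s - T t) = (fun x : ℝ => (x : ℂ)) ''
      Icc 0 (α ^ (-(1 / (α - 1))) - α ^ (-(α / (α - 1)))) := by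
  have hα1 : 1 < α := hα ▸ (one_lt_div hs).2 hst
  have h0 := hpos s hs.le
  have ht : T t = T s ^ α := by
    rw [← semigroup_mul_eq_rpow hT0 hadd hpos hanti hs.le (zero_lt_one.trans hα1), hα,
      div_mul_cancel₀ _ hs.ne']
  have hcont : Continuous fun x : ℝ => x ^ α :=
    Real.continuous_rpow_const (zero_lt_one.trans hα1).le
  have hcfc : T s - T t = cfc (fun x : ℝ => x - x ^ α) (T s) := by
    rw [cfc_sub (fun x : ℝ => x) _ _ (by fun_prop) hcont.continuousOn, cfc_id' ℝ _,
      ht, CFC.rpow_eq_cfc_real h0]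
  rw [spectrum_complex_eq_of_nonneg (sub_nonneg.2 (hanti s t hs.le hst.le)), hcfc,
    cfc_map_spectrum (fun x : ℝ => x - x ^ α) _ (IsSelfAdjoint.of_nonneg h0)
      (continuous_id.sub hcont).continuousOn,
    spectrum_semigroup hT0 hadd hpos hanti hc he hs, image_sub_rpow_Icc hα1]

end Semigroup

/-! ### The spectra for horodiscs and horocyclic strips -/

theorem toeplitzOp_congr {U V Ω : Opens ℂ} (hU : U ≤ Ω) (h : U = V) :
    toeplitzOp hU = toeplitzOp (h ▸ hU : V ≤ Ω) := by
  subst h; rfl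

/-- The Toeplitz operator of `horodisc ζ s`, extended constantly to `s < 0` so as to be defined for
all real `s`. -/
noncomputable def horodiscOp {ζ : ℂ} (hζ : ‖ζ‖ = 1) (s : ℝ) :
    bergmanSpace unitDisc →L[ℂ] bergmanSpace unitDisc :=
  toeplitzOp (horodisc_le hζ (le_max_left 0 s))

theorem horodiscOp_of_nonneg {ζ : ℂ} (hζ : ‖ζ‖ = 1) {s : ℝ} (hs : 0 ≤ s) :
    horodiscOp hζ s = toeplitzOp (horodisc_le hζ hs) :=
  toeplitzOp_congr _ (by rw [max_eq_right hs])

theorem horodiscOp_nonneg {ζ : ℂ} (hζ : ‖ζ‖ = 1) (s : ℝ) : 0 ≤ horodiscOp hζ s :=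
  toeplitzOp_nonneg _

theorem horodiscOp_zero {ζ : ℂ} (hζ : ‖ζ‖ = 1) : horodiscOp hζ 0 = 1 := by
  rw [horodiscOp_of_nonneg hζ le_rfl, toeplitzOp_horodisc_zero hζ]

theorem horodiscOp_add {ζ : ℂ} (hζ : ‖ζ‖ = 1) {s t : ℝ} (hs : 0 ≤ s) (ht : 0 ≤ t) :
    horodiscOp hζ (s + t) = horodiscOp hζ s * horodiscOp hζ t := by
  rw [horodiscOp_of_nonneg hζ hs, horodiscOp_of_nonneg hζ ht,
    horodiscOp_of_nonneg hζ (add_nonneg hs ht), toeplitzOp_horodisc_add hζ hs ht]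

theorem horodiscOp_anti {ζ : ℂ} (hζ : ‖ζ‖ = 1) {s t : ℝ} (hs : 0 ≤ s) (hst : s ≤ t) :
    horodiscOp hζ t ≤ horodiscOp hζ s := by
  rw [horodiscOp_of_nonneg hζ hs, horodiscOp_of_nonneg hζ (hs.trans hst)]
  exact toeplitzOp_mono (horodisc_le hζ hs) (horodisc_anti hζ hs hst)

theorem exists_inner_horodiscOp {ζ : ℂ} (hζ : ‖ζ‖ = 1) : ∃ e : bergmanSpace unitDisc,
    ∀ s, 0 ≤ s → inner ℂ e (horodiscOp hζ s e) = ((Real.pi * (1 / (1 + s)) ^ 2 : ℝ) : ℂ) := by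
  obtain ⟨e, he⟩ := exists_inner_toeplitzOp_horodisc
  exact ⟨e, fun s hs => by rw [horodiscOp_of_nonneg hζ hs, he ζ hζ s hs]⟩

/-- A horocyclic strip is a difference of two horodiscs, up to a circle. -/
theorem toeplitzOp_strip {U : Opens ℂ} (hU : U ≤ unitDisc) {ζ : ℂ} (hζ : ‖ζ‖ = 1) {s t : ℝ}
    (hs : 0 ≤ s) (hst : s ≤ t)
    (h : (U : Set ℂ) = (horodisc ζ s : Set ℂ) \
      closedBall ((1 - (1 + t)⁻¹ : ℝ) * ζ) (1 + t)⁻¹) :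
    toeplitzOp hU = horodiscOp hζ s - horodiscOp hζ t := by
  rw [horodiscOp_of_nonneg hζ hs, horodiscOp_of_nonneg hζ (hs.trans hst), eq_sub_iff_add_eq,
    eq_comm]
  have hsub : (horodisc ζ t : Set ℂ) ⊆ horodisc ζ s := horodisc_anti hζ hs hst
  have hball : (horodisc ζ t : Set ℂ) = ball ((1 - (1 + t)⁻¹ : ℝ) * ζ) (1 + t)⁻¹ := rfl
  refine toeplitzOp_eq_add _ hU _ ?_ ?_
  · rw [h, hball]
    exact disjoint_sdiff_left.mono_right ball_subset_closedBall
  · have hsphere : volume (sphere ((1 - (1 + t)⁻¹ : ℝ) * ζ) (1 + t)⁻¹) = 0 :=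
      Measure.addHaar_sphere_of_ne_zero _ _ (inv_pos.2 (by linarith)).ne'
    filter_upwards [compl_mem_ae_iff.2 hsphere] with z hz
    refine propext ⟨fun hzs => ?_, ?_⟩
    · by_cases hzb : z ∈ closedBall ((1 - (1 + t)⁻¹ : ℝ) * ζ) (1 + t)⁻¹
      · refine Or.inr (hball ▸ ?_)
        rw [← ball_union_sphere] at hzb
        exact hzb.resolve_right hz
      · exact Or.inl (h ▸ ⟨hzs, hzb⟩)
    · rintro (hzU | hzt)
      · rw [h] at hzU
        exact hzU.1
      · exact hsub hzt

end BergmanRestriction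

theorem theorem1p3 (U : TopologicalSpace.Opens ℂ) (hU : U ≤ BergmanRestriction.unitDisc) :
    (BergmanRestriction.IsHorodisc U →
      spectrum ℂ (BergmanRestriction.toeplitzOp hU) =
        (fun x : ℝ => (x : ℂ)) '' Set.Icc 0 1) ∧
    (∀ ρ₁ ρ₂ : ℝ, 0 < ρ₁ → ρ₁ < ρ₂ → ρ₂ < 1 →
      BergmanRestriction.IsHorocyclicStrip U ρ₁ ρ₂ →
      ∀ α : ℝ, α = (1 / ρ₁ - 1) / (1 / ρ₂ - 1) →
        spectrum ℂ (BergmanRestriction.toeplitzOp hU) =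
          (fun x : ℝ => (x : ℂ)) ''
            Set.Icc 0 (α ^ (-(1 / (α - 1))) - α ^ (-(α / (α - 1))))) := by
  open BergmanRestriction in
  constructor
  · rintro ⟨ζ, ρ, hζ, hρ, hρ1, hUρ⟩
    have hs : 0 < 1 / ρ - 1 := sub_pos.2 ((one_lt_div hρ).2 hρ1)
    have hUs : U = horodisc ζ (1 / ρ - 1) := by
      refine TopologicalSpace.Opens.ext (hUρ.trans ?_)
      simp [horodisc]
    obtain ⟨e, he⟩ := exists_inner_horodiscOp hζ
    rw [toeplitzOp_congr hU hUs, ← horodiscOp_of_nonneg hζ hs.le]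
    exact spectrum_complex_semigroup (horodiscOp_zero hζ) (fun _ _ => horodiscOp_add hζ)
      (fun s _ => horodiscOp_nonneg hζ s) (fun _ _ => horodiscOp_anti hζ) Real.pi_pos he hs
  · rintro ρ₁ ρ₂ hρ₁ h12 hρ₂ ⟨ζ, hζ, hUρ⟩ α hα
    have hs : 0 < 1 / ρ₂ - 1 := sub_pos.2 ((one_lt_div (hρ₁.trans h12)).2 hρ₂)
    have hst : 1 / ρ₂ - 1 < 1 / ρ₁ - 1 := sub_lt_sub_right (one_div_lt_one_div_of_lt hρ₁ h12) 1
    obtain ⟨e, he⟩ := exists_inner_horodiscOp hζ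
    have hstrip := toeplitzOp_strip hU hζ hs.le hst.le <| by
      rw [hUρ]
      ext z
      simp [horodisc, dist_eq_norm]
    rw [hstrip]
    exact spectrum_complex_semigroup_sub (horodiscOp_zero hζ) (fun _ _ => horodiscOp_add hζ)
      (fun s _ => horodiscOp_nonneg hζ s) (fun _ _ => horodiscOp_anti hζ) Real.pi_pos he hs hst hα
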